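/- Let $(X,d)$ be a complete CAT(0) space, let $A,B\subseteq X$ be nonempty, closed and (geodesically) convex, and put $D=\operatorname{dist}(A,B)=\inf\{d(a,b): a\in A,\ b\in B\}$ and $$B_0=\{b\in B : d(a,b)=D \text{ for some } a\in A\}.$$ Then each $b\in B_0$ has exactly one proximinal point in $A$, i.e. there is exactly one $b'\in A$ with $d(b',b)=D$. For $x,y\in B_0$ define $$d_1(x,y)=\inf\{r>0 : d(y,x')\le D+r \text{ and } d(y',x)\le D+r\}.$$ Then $d_1$ is a semimetric on $B_0$ (that is, $d_1\ge 0$, $d_1(x,y)=d_1(y,x)$, and $d_1(x,y)=0$ if and only if $x=y$), and it coincides with the metric $d$ on $B_0$ in the sense that, for every $x\in B_0$, the closed balls centred at $x$ of radius $\ge 0$ with respect to $d_1$ are exactly those with respect to $d$ in $B_0$. More precisely, for all $x\in B_0$ and $r\ge 0$, $$\{y\in B_0: d_1(x,y)\le \sqrt{D^2+r^2}-D\}=\{y\in B_0: d(x',y)\le\sqrt{D^2+r^2}\}=\{y\in B_0: d(x,y)\le r\},$$ equivalently, $d_1(x,y)=\sqrt{D^2+d(x,y)^2}-D$ for all $x,y\in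 B_0$. In particular $d_1=d$ on $B_0$ if $D=0$. -/

import Mathlib

namespace CatZero

/-- `c`, restricted to `[0, l]`, is a geodesic from `x` to `y`. -/
def IsGeodesic {X : Type*} [MetricSpace X] (c : ℝ → X) (l : ℝ) (x y : X) : Prop :=
  0 ≤ l ∧ c 0 = x ∧ c l = y ∧
    ∀ t ∈ Set.Icc 0 l, ∀ t' ∈ Set.Icc 0 l, dist (c t) (c t') = |t - t'|

/-- `S` is a geodesic segment (the image of a geodesic) joining `x` and `y`. -/
def IsGeodesicSegment {X : Type*} [MetricSpace X] (S : Set X) (x y : X) : Prop :=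
  ∃ (c : ℝ → X) (l : ℝ), IsGeodesic c l x y ∧ S = c '' Set.Icc 0 l

/-- A CAT(0) space: a geodesic space all of whose geodesic triangles satisfy the CAT(0)
inequality. For a triangle with vertices `p, q, r` and a comparison triangle `p', q', r'` in the
Euclidean plane, two points `x ∈ [p,q]`, `y ∈ [p,r]` are at most as far apart as their comparison
points `x' ∈ [p',q']`, `y' ∈ [p',r']`. Since `p` may be any vertex of the triangle, this covers all
pairs of points on different sides; for points on the same side the inequality is trivial. -/
structure IsCATZero (X : Type*) [MetricSpace X] : Prop where
  exists_segment : ∀ x y : X, ∃ S : Set X, IsGeodesicSegment S x y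
  comparison : ∀ (p q r : X) (Spq Spr Sqr : Set X),
    IsGeodesicSegment Spq p q → IsGeodesicSegment Spr p r → IsGeodesicSegment Sqr q r →
    ∀ p' q' r' : EuclideanSpace ℝ (Fin 2),
      dist p' q' = dist p q → dist p' r' = dist p r → dist q' r' = dist q r →
      ∀ x ∈ Spq, ∀ y ∈ Spr, ∀ x' ∈ segment ℝ p' q', ∀ y' ∈ segment ℝ p' r',
        dist p' x' = dist p x → dist p' y' = dist p y → dist x y ≤ dist x' y'

/-- `A` contains every geodesic segment joining two of its points. -/
def GeodesicallyConvex {X : Type*} [MetricSpace X] (A : Set X) : Prop :=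
  ∀ x ∈ A, ∀ y ∈ A, ∀ S : Set X, IsGeodesicSegment S x y → S ⊆ A

/-- `dist(A, B)`, the infimum of the distances between points of `A` and points of `B`. -/
noncomputable def setDist {X : Type*} [MetricSpace X] (A B : Set X) : ℝ :=
  sInf (Set.image2 dist A B)

/-- The set `B₀` of the points of `B` at distance `dist(A, B)` from some point of `A`. -/
def proximinalPts {X : Type*} [MetricSpace X] (A B : Set X) : Set X :=
  {y | y ∈ B ∧ ∃ x, x ∈ A ∧ dist x y = setDist A B}

/-- The proximinal point (written `b - h`) in `A` of a point `b` of `B₀`. -/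
noncomputable def proxPt {X : Type*} [MetricSpace X] (A B : Set X) (b : proximinalPts A B) : X :=
  b.2.2.choose

/-- The function `d₁` on `B₀ × B₀`. -/
noncomputable def dOne {X : Type*} [MetricSpace X] (A B : Set X)
    (x y : proximinalPts A B) : ℝ :=
  sInf {r : ℝ | 0 < r ∧ (y : X) ∈ Metric.closedBall (proxPt A B x) (setDist A B + r) ∧
    proxPt A B y ∈ Metric.closedBall (x : X) (setDist A B + r)}

structure IsSemimetric {M : Type*} (ρ : M → M → ℝ) : Prop where
  nonneg : ∀ x y, 0 ≤ ρ x y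
  eq_zero_iff : ∀ x y, ρ x y = 0 ↔ x = y
  symm : ∀ x y, ρ x y = ρ y x

/-- The closed ball of a semimetric. -/
def semiBall {M : Type*} (ρ : M → M → ℝ) (x : M) (r : ℝ) : Set M :=
  {y | ρ x y ≤ r}

end CatZero

namespace CatZero

/-! Write `D` for the distance of the sets. Since `x'` is a nearest point of `A` to `x`, and `x` of
`B` to `x'`, convexity gives Pythagorean inequalities that bound the squared diagonals `d(x', y)`
and `d(x, y')` below by `D² + d(x, y)²` and `D² + d(x', y')²`. The CAT(0) quadrilateral inequality
bounds the sum of the squared diagonals above by `2D² + d(x, y)² + d(x', y')²`. Hence equality holds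
throughout, and `d(x', y)² = D² + d(x, y)²`, from which everything about `d₁` follows. -/

/-- Three nonnegative reals satisfying the triangle inequalities are the side lengths of a
Euclidean triangle `0, q, r` in the plane. -/
theorem exists_comparison_triangle {a b c : ℝ} (ha : 0 ≤ a) (hb : 0 ≤ b) (hc : 0 ≤ c)
    (h₁ : a ≤ b + c) (h₂ : b ≤ a + c) (h₃ : c ≤ a + b) :
    ∃ q r : EuclideanSpace ℝ (Fin 2), ‖q‖ = a ∧ ‖r‖ = b ∧ ‖q - r‖ = c := by
  obtain ⟨u, v, huv, huv'⟩ : ∃ u v : ℝ, u ^ 2 + v ^ 2 = a ^ 2 ∧ (u - b) ^ 2 + v ^ 2 = c ^ 2 := by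
    rcases hb.eq_or_lt with rfl | hb
    · exact ⟨a, 0, by ring, by rw [show c = a by linarith]; ring⟩
    -- Law of cosines, with `r` on the first axis; the triangle inequalities make `a ^ 2 - u ^ 2`
    -- nonnegative.
    · set u := (a ^ 2 + b ^ 2 - c ^ 2) / (2 * b) with hu
      have hub : 2 * b * u = a ^ 2 + b ^ 2 - c ^ 2 := by rw [hu]; field_simp
      have hua : u ^ 2 ≤ a ^ 2 := by
        refine sq_le_sq' ?_ ?_
        · have : 0 ≤ (a + b - c) * (a + b + c) := mul_nonneg (by linarith) (by linarith)
          rw [hu, le_div_iff₀ (by positivity)]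
          linarith
        · have : 0 ≤ (a - b + c) * (b + c - a) := mul_nonneg (by linarith) (by linarith)
          rw [hu, div_le_iff₀ (by positivity)]
          linarith
      have hv : √(a ^ 2 - u ^ 2) ^ 2 = a ^ 2 - u ^ 2 := Real.sq_sqrt (by linarith)
      exact ⟨u, √(a ^ 2 - u ^ 2), by rw [hv]; ring, by rw [hv]; linarith⟩
  refine ⟨!₂[u, v], !₂[b, 0], ?_, ?_, ?_⟩
  · simp [EuclideanSpace.norm_eq, huv, ha]
  · simp [EuclideanSpace.norm_eq, hb]
  · simp [EuclideanSpace.norm_eq, huv', hc]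

/-- Stewart's identity in an inner product space. -/
theorem norm_sub_smul_sq {E : Type*} [NormedAddCommGroup E] [InnerProductSpace ℝ E]
    (q r : E) (t : ℝ) :
    ‖q - t • r‖ ^ 2 = (1 - t) * ‖q‖ ^ 2 + t * ‖q - r‖ ^ 2 - t * (1 - t) * ‖r‖ ^ 2 := by
  rw [norm_sub_sq_real, norm_sub_sq_real, real_inner_smul_right, norm_smul, mul_pow,
    Real.norm_eq_abs, sq_abs]
  ring

variable {X : Type*} [MetricSpace X]

/-- The CN inequality of Bruhat and Tits, at an arbitrary point of a geodesic segment. -/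
theorem IsCATZero.dist_sq_le (hX : IsCATZero X) {S : Set X} {p r : X}
    (hS : IsGeodesicSegment S p r) {t : ℝ} (ht₀ : 0 ≤ t) (ht₁ : t ≤ 1) :
    ∃ y ∈ S, ∀ z, dist z y ^ 2 ≤
      (1 - t) * dist z p ^ 2 + t * dist z r ^ 2 - t * (1 - t) * dist p r ^ 2 := by
  have hS' := hS
  obtain ⟨c, l, ⟨hl, h₀, h₁, hc⟩, rfl⟩ := hS'
  have hpr : dist p r = l := by
    rw [← h₀, ← h₁, hc 0 ⟨le_rfl, hl⟩ l ⟨hl, le_rfl⟩, zero_sub, abs_neg, abs_of_nonneg hl]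
  have hmem : t * l ∈ Set.Icc 0 l := ⟨by positivity, mul_le_of_le_one_left hl ht₁⟩
  have hpy : dist p (c (t * l)) = t * l := by
    rw [← h₀, hc 0 ⟨le_rfl, hl⟩ _ hmem, zero_sub, abs_neg, abs_of_nonneg hmem.1]
  refine ⟨c (t * l), ⟨_, hmem, rfl⟩, fun z => ?_⟩
  obtain ⟨Spz, hpz⟩ := hX.exists_segment p z
  obtain ⟨Szr, hzr⟩ := hX.exists_segment z r
  have hz : z ∈ Spz := by
    obtain ⟨c', l', ⟨hl', -, h', -⟩, rfl⟩ := hpz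
    exact ⟨l', ⟨hl', le_rfl⟩, h'⟩
  obtain ⟨q', r', hq, hr, hqr⟩ := exists_comparison_triangle (a := dist p z) (b := dist p r)
    (c := dist z r) dist_nonneg dist_nonneg dist_nonneg
    (by simpa only [dist_comm z r] using dist_triangle p r z) (dist_triangle p z r)
    (by simpa only [dist_comm p z] using dist_triangle z p r)
  -- Only one point is interior to a side: the other is the vertex `z`, so Stewart's identity
  -- computes the comparison distance.
  have key := hX.comparison p z r Spz _ Szr hpz hS hzr 0 q' r' (by simpa using hq)
    (by simpa using hr) (by rw [dist_eq_norm, hqr]) z hz (c (t * l)) ⟨_, hmem, rfl⟩ q'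
    (right_mem_segment ℝ 0 q') (t • r')
    ⟨1 - t, t, by linarith, ht₀, by ring, by simp⟩ (by simpa using hq)
    (by rw [dist_zero_left, norm_smul, hr, hpy, hpr, Real.norm_eq_abs, abs_of_nonneg ht₀])
  calc dist z (c (t * l)) ^ 2 ≤ dist q' (t • r') ^ 2 := by gcongr
    _ = _ := by rw [dist_eq_norm, norm_sub_smul_sq, hq, hr, hqr, dist_comm p z]

/-- The sum of the squares of the diagonals of a quadrilateral is at most that of its sides. -/
theorem IsCATZero.quadrilateral (hX : IsCATZero X) (x a b y : X) :
    dist x b ^ 2 + dist a y ^ 2 ≤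
      dist x a ^ 2 + dist a b ^ 2 + dist b y ^ 2 + dist y x ^ 2 := by
  obtain ⟨S, hS⟩ := hX.exists_segment x b
  obtain ⟨m, -, hm⟩ := hX.dist_sq_le hS (t := 1 / 2) (by norm_num) (by norm_num)
  have ha := hm a
  have hy := hm y
  rw [dist_comm a x] at ha
  rw [dist_comm y b] at hy
  have h : dist a y ^ 2 ≤ (dist a m + dist y m) ^ 2 := by
    gcongr
    exact dist_triangle_right a y m
  -- Add the midpoint inequalities at `a` and `y`, using `(s + t)² ≤ 2s² + 2t²`.
  nlinarith [sq_nonneg (dist a m - dist y m)]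

/-- The Pythagorean inequality for a nearest point `p` of `z` in a convex set. -/
theorem IsCATZero.dist_sq_add_dist_sq_le (hX : IsCATZero X) {A : Set X}
    (hA : GeodesicallyConvex A) {z p w : X} (hp : p ∈ A) (hmin : ∀ a ∈ A, dist z p ≤ dist z a)
    (hw : w ∈ A) : dist z p ^ 2 + dist p w ^ 2 ≤ dist z w ^ 2 := by
  obtain ⟨S, hS⟩ := hX.exists_segment p w
  -- Compare `p` with the point at parameter `t` towards `w`, divide by `t`, then let `t → 0`.
  have key : ∀ t : ℝ, 0 < t → t ≤ 1 →
      dist z p ^ 2 + dist p w ^ 2 ≤ dist z w ^ 2 + t * dist p w ^ 2 := by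
    intro t ht₀ ht₁
    obtain ⟨y, hy, h⟩ := hX.dist_sq_le hS ht₀.le ht₁
    have hle : dist z p ^ 2 ≤ dist z y ^ 2 := by
      gcongr
      exact hmin y (hA p hp w hw S hS hy)
    refine le_of_mul_le_mul_left ?_ ht₀
    linarith [h z]
  have hlim : Filter.Tendsto (fun t : ℝ => dist z w ^ 2 + t * dist p w ^ 2)
      (nhdsWithin 0 (Set.Ioi 0)) (nhds (dist z w ^ 2)) := by
    have : Continuous fun t : ℝ => dist z w ^ 2 + t * dist p w ^ 2 := by fun_prop
    simpa using (this.tendsto 0).mono_left nhdsWithin_le_nhds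
  refine ge_of_tendsto hlim ?_
  filter_upwards [Ioc_mem_nhdsGT (zero_lt_one' ℝ)] with t ht using key t ht.1 ht.2

theorem setDist_le_dist {A B : Set X} {a b : X} (ha : a ∈ A) (hb : b ∈ B) :
    setDist A B ≤ dist a b :=
  csInf_le ⟨0, by rintro _ ⟨a, -, b, -, rfl⟩; exact dist_nonneg⟩ ⟨a, ha, b, hb, rfl⟩

theorem setDist_nonneg (A B : Set X) : 0 ≤ setDist A B :=
  Real.sInf_nonneg (by rintro _ ⟨a, -, b, -, rfl⟩; exact dist_nonneg)

theorem proxPt_mem {A B : Set X} (b : proximinalPts A B) : proxPt A B b ∈ A :=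
  b.2.2.choose_spec.1

theorem dist_proxPt {A B : Set X} (b : proximinalPts A B) :
    dist (proxPt A B b) (b : X) = setDist A B :=
  b.2.2.choose_spec.2

/-- Two nearest points have equal distance to `b`, so the Pythagorean inequality leaves no room
between them. -/
theorem IsCATZero.existsUnique_prox (hX : IsCATZero X) {A B : Set X}
    (hA : GeodesicallyConvex A) (b : proximinalPts A B) :
    ∃! a, a ∈ A ∧ dist a (b : X) = setDist A B := by
  refine ⟨proxPt A B b, ⟨proxPt_mem b, dist_proxPt b⟩, ?_⟩
  rintro w ⟨hw, hwd⟩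
  have h := hX.dist_sq_add_dist_sq_le hA (z := (b : X)) (proxPt_mem b) (fun a ha => by
    rw [dist_comm, dist_proxPt, dist_comm]; exact setDist_le_dist ha b.2.1) hw
  rw [dist_comm (b : X), dist_proxPt, dist_comm (b : X), hwd] at h
  have h0 : dist (proxPt A B b) w = 0 :=
    pow_eq_zero_iff two_ne_zero |>.1 (le_antisymm (by linarith) (sq_nonneg _))
  exact (dist_eq_zero.1 h0).symm

/-- The four points `x`, `y` and their proximinal points span a rectangle. -/
theorem IsCATZero.dist_proxPt_sq (hX : IsCATZero X) {A B : Set X}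
    (hA : GeodesicallyConvex A) (hB : GeodesicallyConvex B) (x y : proximinalPts A B) :
    dist (proxPt A B x) (y : X) ^ 2 = setDist A B ^ 2 + dist x y ^ 2 := by
  have hAmin (u v : proximinalPts A B) := hX.dist_sq_add_dist_sq_le hA (z := (u : X))
    (proxPt_mem u) (fun a ha => by
      rw [dist_comm, dist_proxPt, dist_comm]; exact setDist_le_dist ha u.2.1) (proxPt_mem v)
  have hBmin (u v : proximinalPts A B) := hX.dist_sq_add_dist_sq_le hB (z := proxPt A B u)
    u.2.1 (fun b hb => by rw [dist_proxPt]; exact setDist_le_dist (proxPt_mem u) hb) v.2.1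
  have h₁ := hAmin x y
  have h₂ := hAmin y x
  have h₃ := hBmin x y
  have h₄ := hBmin y x
  have hq := hX.quadrilateral (x : X) (proxPt A B x) (proxPt A B y) (y : X)
  simp only [dist_comm _ (proxPt A B x), dist_comm (y : X) (proxPt A B y),
    dist_comm (x : X) (proxPt A B y), dist_comm (y : X) (x : X), dist_proxPt] at h₁ h₂ h₃ h₄ hq
  rw [Subtype.dist_eq]
  linarith

theorem IsCATZero.dist_proxPt_eq (hX : IsCATZero X) {A B : Set X}
    (hA : GeodesicallyConvex A) (hB : GeodesicallyConvex B) (x y : proximinalPts A B) :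
    dist (proxPt A B x) (y : X) = √(setDist A B ^ 2 + dist x y ^ 2) := by
  rw [← hX.dist_proxPt_sq hA hB, Real.sqrt_sq dist_nonneg]

/-- Requiring `0 < r` in `d₁` does not change the infimum, even for `s = 0`. -/
theorem sInf_pos_and_le {s : ℝ} (hs : 0 ≤ s) : sInf {r : ℝ | 0 < r ∧ s ≤ r} = s := by
  refine csInf_eq_of_forall_ge_of_forall_gt_exists_lt ⟨s + 1, by linarith, by linarith⟩
    (fun r hr => hr.2) fun w hw => ?_
  exact ⟨(s + w) / 2, ⟨by linarith, by linarith⟩, by linarith⟩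

theorem le_sqrt_sq_add_sq {D : ℝ} (r : ℝ) : D ≤ √(D ^ 2 + r ^ 2) :=
  Real.le_sqrt_of_sq_le (by linarith [sq_nonneg r])

theorem sqrt_sq_add_sq_le_iff {D r s : ℝ} (hr : 0 ≤ r) (hs : 0 ≤ s) :
    √(D ^ 2 + r ^ 2) ≤ √(D ^ 2 + s ^ 2) ↔ r ≤ s := by
  rw [Real.sqrt_le_sqrt_iff (by positivity), add_le_add_iff_left, sq_le_sq₀ hr hs]

/-- The two diagonals are equal, so both ball conditions are the same bound on `r`. -/
theorem IsCATZero.dOne_eq (hX : IsCATZero X) {A B : Set X}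
    (hA : GeodesicallyConvex A) (hB : GeodesicallyConvex B) (x y : proximinalPts A B) :
    dOne A B x y = √(setDist A B ^ 2 + dist x y ^ 2) - setDist A B := by
  rw [← sInf_pos_and_le (sub_nonneg.2 (le_sqrt_sq_add_sq (D := setDist A B) (dist x y))), dOne]
  congr 1
  ext r
  rw [Set.mem_ofPred_eq, Set.mem_ofPred_eq, Metric.mem_closedBall', Metric.mem_closedBall,
    hX.dist_proxPt_eq hA hB, hX.dist_proxPt_eq hA hB, dist_comm y x, and_self_iff,
    sub_le_iff_le_add']

theorem IsCATZero.semiBall_dOne (hX : IsCATZero X) {A B : Set X}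
    (hA : GeodesicallyConvex A) (hB : GeodesicallyConvex B) (x : proximinalPts A B)
    {r : ℝ} (hr : 0 ≤ r) :
    semiBall (dOne A B) x (√(setDist A B ^ 2 + r ^ 2) - setDist A B) =
      Metric.closedBall x r := by
  ext y
  rw [semiBall, Set.mem_ofPred_eq, hX.dOne_eq hA hB, sub_le_sub_iff_right,
    sqrt_sq_add_sq_le_iff dist_nonneg hr, Metric.mem_closedBall']

theorem IsCATZero.isSemimetric_dOne (hX : IsCATZero X) {A B : Set X}
    (hA : GeodesicallyConvex A) (hB : GeodesicallyConvex B) : IsSemimetric (dOne A B) where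
  nonneg x y := by
    rw [hX.dOne_eq hA hB]
    exact sub_nonneg.2 (le_sqrt_sq_add_sq _)
  eq_zero_iff x y := by
    rw [hX.dOne_eq hA hB, sub_eq_zero, Real.sqrt_eq_iff_eq_sq (by positivity) (setDist_nonneg A B),
      add_eq_left, sq_eq_zero_iff, dist_eq_zero]
  symm x y := by rw [hX.dOne_eq hA hB, hX.dOne_eq hA hB, dist_comm]

end CatZero

theorem mainTheorem9 {X : Type*} [MetricSpace X] [CompleteSpace X] (hX : CatZero.IsCATZero X)
    (A B : Set X) (hAne : A.Nonempty) (hBne : B.Nonempty)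
    (hAc : IsClosed A) (hBc : IsClosed B)
    (hA : CatZero.GeodesicallyConvex A) (hB : CatZero.GeodesicallyConvex B) :
    -- the proximinal point in `A` of a point of `B₀` is unique, so that `d₁` is well defined
    (∀ b : CatZero.proximinalPts A B, ∃! a, a ∈ A ∧ dist a (b : X) = CatZero.setDist A B) ∧
    CatZero.IsSemimetric (CatZero.dOne A B) ∧
    -- at each point, `d₁` and the metric have the same closed balls
    (∀ x : CatZero.proximinalPts A B,
      {U | ∃ s : ℝ, 0 ≤ s ∧ U = CatZero.semiBall (CatZero.dOne A B) x s} =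
        {U | ∃ r : ℝ, 0 ≤ r ∧ U = Metric.closedBall x r}) ∧
    -- with the following correspondence of radii
    (∀ (x : CatZero.proximinalPts A B) (r : ℝ), 0 ≤ r →
      CatZero.semiBall (CatZero.dOne A B) x
          (√(CatZero.setDist A B ^ 2 + r ^ 2) - CatZero.setDist A B) =
        {y : CatZero.proximinalPts A B | (y : X) ∈ Metric.closedBall (CatZero.proxPt A B x)
          (√(CatZero.setDist A B ^ 2 + r ^ 2))} ∧
      {y : CatZero.proximinalPts A B | (y : X) ∈ Metric.closedBall (CatZero.proxPt A B x)
          (√(CatZero.setDist A B ^ 2 + r ^ 2))} = Metric.closedBall x r) ∧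
    -- equivalently, `d₁` is the following function of the metric
    (∀ x y : CatZero.proximinalPts A B,
      CatZero.dOne A B x y =
        √(CatZero.setDist A B ^ 2 + dist x y ^ 2) - CatZero.setDist A B) ∧
    (CatZero.setDist A B = 0 → ∀ x y : CatZero.proximinalPts A B,
      CatZero.dOne A B x y = dist x y) := by
  refine ⟨hX.existsUnique_prox hA, hX.isSemimetric_dOne hA hB, fun x => ?_, fun x r hr => ?_,
    hX.dOne_eq hA hB, fun hD x y => ?_⟩
  · ext U
    constructor
    · rintro ⟨s, hs, rfl⟩
      have hD := CatZero.setDist_nonneg A B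
      have hsq : 0 ≤ (CatZero.setDist A B + s) ^ 2 - CatZero.setDist A B ^ 2 := by
        nlinarith [mul_nonneg hD hs]
      -- This radius solves `√(D² + r²) - D = s`.
      refine ⟨√((CatZero.setDist A B + s) ^ 2 - CatZero.setDist A B ^ 2), Real.sqrt_nonneg _, ?_⟩
      rw [← hX.semiBall_dOne hA hB x (Real.sqrt_nonneg _), Real.sq_sqrt hsq, add_sub_cancel,
        Real.sqrt_sq (by positivity), add_sub_cancel_left]
    · rintro ⟨r, hr, rfl⟩
      exact ⟨_, sub_nonneg.2 (CatZero.le_sqrt_sq_add_sq r), (hX.semiBall_dOne hA hB x hr).symm⟩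
  · have h : {y : CatZero.proximinalPts A B | (y : X) ∈ Metric.closedBall (CatZero.proxPt A B x)
        (√(CatZero.setDist A B ^ 2 + r ^ 2))} = Metric.closedBall x r := by
      ext y
      rw [Set.mem_ofPred_eq, Metric.mem_closedBall', Metric.mem_closedBall',
        hX.dist_proxPt_eq hA hB, CatZero.sqrt_sq_add_sq_le_iff dist_nonneg hr]
    exact ⟨(hX.semiBall_dOne hA hB x hr).trans h.symm, h⟩
  · rw [hX.dOne_eq hA hB, hD, zero_pow two_ne_zero, zero_add, sub_zero, Real.sqrt_sq dist_nonneg]
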